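/- **Proposition (the smooth worm has nontrivial Nebenhülle).** Let $\mu>\pi/2$ and let $\eta:\mathbf R\to\mathbf R$ be a $C^\infty$ function such that: $\eta\ge 0$, $\eta$ is even and convex; $\eta^{-1}(0)=[-\mu,\mu]$; there is $a>0$ with $\eta(x)>1$ whenever $|x|>a$; and $\eta'(x)\neq 0$ whenever $\eta(x)=1$. Let $$\mathcal W=\Big\{(z_1,z_2)\in\mathbf C^2:\ z_2\ne 0,\ \big|z_1-e^{i\log|z_2|^2}\big|^2<1-\eta(\log|z_2|^2)\Big\}$$ be the corresponding smooth worm domain. By a *pseudoconvex neighborhood* of $\overline{\mathcal W}$ we mean a set $U\supseteq\overline{\mathcal W}$ that is either an open set admitting a continuous plurisubharmonic exhaustion function, or a bounded domain with $C^\infty$ boundary that is Levi pseudoconvex. Then: 1. $\mathcal W$ has nontrivial Nebenhülle, i.e. there is no sequence of smoothly bounded, Levi pseudoconvex domains $W_1\supset\supset W_2\supset\supset\cdots\supset\supset\overline{\mathcal W}$ with $\bigcap_j W_j=\overline{\mathcal W}$. 2. The pseudoconvex neighborhoods of $\overline{\mathcal W}$ do not form a neighborhood basis of $\overline{\mathcal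 W}$: some open $V\supseteq\overline{\mathcal W}$ contains no pseudoconvex neighborhood of $\overline{\mathcal W}$. 3. For every $\tau$ with $\pi/2<\tau\le\min(\mu,\pi)$, the set $$\widehat K_\tau=\big\{(z_1,z_2)\in\mathbf C^2:\ z_2\neq 0,\ \big|\log|z_2|^2\big|\le\tau,\ |z_1-e^{i\tau}|\le 1,\ |z_1-e^{-i\tau}|\le 1\big\}$$ is not contained in $\overline{\mathcal W}$, but it is contained in every pseudoconvex neighborhood of $\overline{\mathcal W}$. In particular, if $\mu\ge\pi$, every pseudoconvex neighborhood of $\overline{\mathcal W}$ contains $\{(z_1,z_2):\ -\pi\le\log|z_2|^2\le\pi,\ |z_1+1|\le 1\}$. -/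

import Mathlib

open scoped ContDiff

/-- The admissible profiles `η` of the smooth worm with parameter `μ`: smooth, nonnegative, even,
convex, vanishing exactly on `[-μ, μ]`, larger than `1` far out, and with nonzero derivative
wherever `η = 1`. -/
structure IsWormProfile (μ : ℝ) (η : ℝ → ℝ) : Prop where
  smooth : ContDiff ℝ ∞ η
  nonneg : ∀ x, 0 ≤ η x
  even : ∀ x, η (-x) = η x
  convex : ConvexOn ℝ Set.univ η
  zero_set : η ⁻¹' {0} = Set.Icc (-μ) μ
  large : ∃ a : ℝ, 0 < a ∧ ∀ x, a < |x| → 1 < η x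
  deriv_ne_zero : ∀ x, η x = 1 → deriv η x ≠ 0

/-- The winding angle `log |z₂|²`. -/
noncomputable def wormAngle (w : ℂ) : ℝ := Real.log (‖w‖ ^ 2)

/-- The worm domain
`{(z₁, z₂) : |z₁ - exp (i log |z₂|²)|² < 1 - η (log |z₂|²)}` in `ℂ²`.
The expression `log |z₂|²` makes sense only for `z₂ ≠ 0`. -/
def wormDomain (η : ℝ → ℝ) : Set (ℂ × ℂ) :=
  {z | z.2 ≠ 0 ∧
    ‖z.1 - Complex.exp (Complex.I * (wormAngle z.2 : ℂ))‖ ^ 2 < 1 - η (wormAngle z.2)}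

/-- The filled Hartogs figure of height `τ`: all annuli `{z₁} × {|log |z₂|²| ≤ τ}` for `z₁` in
the intersection of the two closed unit discs centred at `exp (iτ)` and `exp (-iτ)`. For `τ = π`
both discs are `|z₁ + 1| ≤ 1`. -/
def filledHartogsFigure (τ : ℝ) : Set (ℂ × ℂ) :=
  {z | z.2 ≠ 0 ∧ |wormAngle z.2| ≤ τ ∧
    ‖z.1 - Complex.exp (Complex.I * (τ : ℂ))‖ ≤ 1 ∧
    ‖z.1 - Complex.exp (-(Complex.I * (τ : ℂ)))‖ ≤ 1}

/-- A continuous plurisubharmonic function on an open set `U` of `ℂ²`: the sub-mean value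
inequality holds on every closed affine complex disc contained in `U`. -/
def IsContinuousPSHOn (φ : ℂ × ℂ → ℝ) (U : Set (ℂ × ℂ)) : Prop :=
  ContinuousOn φ U ∧
    ∀ z w : ℂ × ℂ, (∀ ζ : ℂ, ‖ζ‖ ≤ 1 → z + ζ • w ∈ U) →
      φ z ≤ Real.circleAverage (fun ζ : ℂ => φ (z + ζ • w)) 0 1

/-- Pseudoconvexity of an open set of `ℂ²`, without boundary regularity: there is a continuous
plurisubharmonic exhaustion function. -/
def IsPseudoconvex (U : Set (ℂ × ℂ)) : Prop :=
  IsOpen U ∧ ∃ φ : ℂ × ℂ → ℝ, IsContinuousPSHOn φ U ∧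
    ∀ c : ℝ, IsCompact {z ∈ U | φ z ≤ c}

/-- `r` is a smooth defining function of `Ω`. -/
structure IsSmoothDefiningFunction (r : ℂ × ℂ → ℝ) (Ω : Set (ℂ × ℂ)) : Prop where
  smooth : ContDiff ℝ ∞ r
  eq_neg : Ω = {z | r z < 0}
  fderiv_ne_zero : ∀ p, r p = 0 → fderiv ℝ r p ≠ 0

/-- The complex tangential condition `∑ⱼ (∂r/∂zⱼ)(p) wⱼ = 0`, written with the real derivative:
`2 ∑ⱼ (∂r/∂zⱼ)(p) wⱼ = dr(p) w - i dr(p) (i w)`. -/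
def IsComplexTangent (r : ℂ × ℂ → ℝ) (p w : ℂ × ℂ) : Prop :=
  fderiv ℝ r p w = 0 ∧ fderiv ℝ r p (Complex.I • w) = 0

/-- The Levi form `∑ⱼₖ (∂²r/∂zⱼ∂z̄ₖ)(p) wⱼ w̄ₖ`, that is, a quarter of the Laplacian at `ζ = 0` of
`ζ ↦ r (p + ζ w)`. -/
noncomputable def leviForm (r : ℂ × ℂ → ℝ) (p w : ℂ × ℂ) : ℝ :=
  (fderiv ℝ (fderiv ℝ r) p w w +
    fderiv ℝ (fderiv ℝ r) p (Complex.I • w) (Complex.I • w)) / 4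

/-- A smoothly bounded (Levi) pseudoconvex domain in `ℂ²`. -/
def IsSmoothlyBoundedPseudoconvexDomain (Ω : Set (ℂ × ℂ)) : Prop :=
  IsConnected Ω ∧ Bornology.IsBounded Ω ∧
    ∃ r : ℂ × ℂ → ℝ, IsSmoothDefiningFunction r Ω ∧
      ∀ p ∈ frontier Ω, ∀ w, IsComplexTangent r p w → 0 ≤ leviForm r p w

/-- `Ω` has a Stein neighbourhood basis: there are smoothly bounded pseudoconvex domains
`W₀ ⊃⊃ W₁ ⊃⊃ ⋯ ⊃⊃ closure Ω` with intersection `closure Ω`. -/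
def HasSteinNeighborhoodBasis (Ω : Set (ℂ × ℂ)) : Prop :=
  ∃ W : ℕ → Set (ℂ × ℂ),
    (∀ j, IsSmoothlyBoundedPseudoconvexDomain (W j)) ∧
    (∀ j, closure (W (j + 1)) ⊆ W j) ∧
    (∀ j, closure Ω ⊆ W j) ∧
    ⋂ j, W j = closure Ω

/-- Nontrivial Nebenhülle: there is no Stein neighbourhood basis. -/
def HasNontrivialNebenhulle (Ω : Set (ℂ × ℂ)) : Prop :=
  ¬ HasSteinNeighborhoodBasis Ω

/-!
The proof is the continuity principle. Each slice `{z₁} × {|log |z₂|²| ≤ τ}` of the filled Hartogs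
figure is joined to `{0} × {|log |z₂|²| ≤ τ}` by the slices over `t z₁`, `0 ≤ t ≤ 1`. Where `η = 0`,
the discs of the worm are the unit discs centred on the unit circle. Their closures contain `0`, so
the slice over `0` lies in the closure of the worm. So do the boundaries of the other slices, for
which only the discs centred at `exp (± iτ)` matter: they contain `0` and `z₁`, and they are convex.
A pseudoconvex neighbourhood therefore contains the whole family. For `cos τ < 0` the point
`(2 cos τ, 1)` lies in the filled figure, but not in the closure of the worm, since the disc over
`z₂ = 1` is centred at `1`.

For a smoothly bounded domain `{r < 0}`, Levi pseudoconvexity yields the continuity principle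
without an exhaustion function. Moving a point to the boundary and a vector to a complex tangent one
shows that the Levi form in the `z₂`-direction is at least `-K (|r| + |∂r/∂z₂|)` near the boundary.
At a local maximum of `r exp (-C |z₂|²)` along a slice, `∂r/∂z₂` is `C r` times the conjugate of
`z₂`, and for large `C` the second derivative test contradicts this bound where `r < 0`. Hence the
maximum over a slice inside the domain is attained on the boundary of the slice or away from the
boundary of the domain.
-/

open Filter Metric Set Topology

section GeneralFacts

theorem exists_eventually_nhdsSet_of_forall_exists_eventually {X α : Type*} [TopologicalSpace X]
    [Preorder α] [IsDirectedOrder α] [Nonempty α] {s : Set X} (hs : IsCompact s)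
    {P : α → X → Prop} (hP : ∀ x, Monotone (P · x)) (h : ∀ x ∈ s, ∃ k, ∀ᶠ y in 𝓝 x, P k y) :
    ∃ k, ∀ᶠ y in 𝓝ˢ s, P k y := by
  refine hs.induction_on (p := fun t => ∃ k, ∀ᶠ y in 𝓝ˢ t, P k y) (by simp) ?_ ?_ ?_
  · rintro t u htu ⟨k, hk⟩
    exact ⟨k, hk.filter_mono (nhdsSet_mono htu)⟩
  · rintro t u ⟨k, hk⟩ ⟨l, hl⟩
    obtain ⟨m, hkm, hlm⟩ := exists_ge_ge k l
    exact ⟨m, (hk.mono fun y => hP y hkm).union (hl.mono fun y => hP y hlm)⟩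
  · intro x hx
    obtain ⟨k, hk⟩ := h x hx
    exact ⟨_, mem_nhdsWithin_of_mem_nhds hk.eventually_nhds, k,
      eventually_nhdsSet_iff_forall.2 fun _ => id⟩

theorem norm_apply_self_sub_apply_self_le {𝕜 E F : Type*} [NontriviallyNormedField 𝕜]
    [SeminormedAddCommGroup E] [NormedSpace 𝕜 E] [SeminormedAddCommGroup F] [NormedSpace 𝕜 F]
    (B : E →L[𝕜] E →L[𝕜] F) (x y : E) :
    ‖B x x - B y y‖ ≤ ‖B‖ * (‖x - y‖ * (‖x‖ + ‖y‖)) :=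
  calc ‖B x x - B y y‖ = ‖B (x - y) x + B y (x - y)‖ := by simp
    _ ≤ ‖B‖ * ‖x - y‖ * ‖x‖ + ‖B‖ * ‖y‖ * ‖x - y‖ :=
      norm_add_le_of_le (B.le_opNorm₂ _ _) (B.le_opNorm₂ _ _)
    _ = ‖B‖ * (‖x - y‖ * (‖x‖ + ‖y‖)) := by ring

theorem norm_smul_sub_le_norm {E : Type*} [SeminormedAddCommGroup E] [NormedSpace ℝ E] {a c : E}
    (ha : ‖a - c‖ ≤ ‖c‖) {t : ℝ} (ht : t ∈ Icc (0 : ℝ) 1) : ‖t • a - c‖ ≤ ‖c‖ := by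
  have h := (convex_closedBall c ‖c‖).smul_mem_of_zero_mem (by simp)
    (mem_closedBall_iff_norm.2 ha) ht
  exact mem_closedBall_iff_norm.1 h

theorem frontier_setOf_neg_eq {E : Type*} [NormedAddCommGroup E] [NormedSpace ℝ E] {r : E → ℝ}
    (hr : Continuous r) (hd : ∀ p, r p = 0 → fderiv ℝ r p ≠ 0) :
    frontier {p | r p < 0} = {p | r p = 0} := by
  refine (frontier_lt_subset_eq hr continuous_const).antisymm fun p hp => ⟨?_, fun hint => ?_⟩
  · by_contra hcl
    refine hd p hp (IsLocalMin.fderiv_eq_zero ?_)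
    filter_upwards [isClosed_closure.isOpen_compl.mem_nhds hcl] with q hq
    rw [show r p = 0 from hp]
    exact not_lt.1 fun hneg => hq (subset_closure hneg)
  · exact (show p ∈ {p | r p < 0} from interior_subset hint).ne hp

section LevelSet

variable {𝕜 E F : Type*} [NontriviallyNormedField 𝕜] [NormedAddCommGroup E] [NormedSpace 𝕜 E]
  [CompleteSpace E] [NormedAddCommGroup F] [NormedSpace 𝕜 F] [CompleteSpace F]
  {f : E → F} {f' : E →L[𝕜] F} {a : E}

theorem exists_norm_sub_le_mul_of_hasStrictFDerivAt (hf : HasStrictFDerivAt f f' a)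
    (hf' : f'.range = ⊤) :
    ∃ K : ℝ, ∀ᶠ p in 𝓝 a, ∃ q, f q = f a ∧ ‖q - p‖ ≤ K * ‖f p - f a‖ := by
  let g := f'.nonlinearRightInverseOfSurjective hf'
  have hg : 0 < g.nnnorm := f'.nonlinearRightInverseOfSurjective_nnnorm_pos hf'
  obtain ⟨s, hs, happrox⟩ := hf.approximates_deriv_on_nhds (c := g.nnnorm⁻¹ / 2)
    (Or.inr (by positivity))
  obtain ⟨ε, hε, hεs⟩ := nhds_basis_closedBall.mem_iff.1 hs
  refine ⟨2 * g.nnnorm, ?_⟩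
  have hsmall : ∀ᶠ p in 𝓝 a, 2 * g.nnnorm * ‖f p - f a‖ + dist p a < ε := by
    have hcont : ContinuousAt (fun p => 2 * g.nnnorm * ‖f p - f a‖ + dist p a) a :=
      (continuousAt_const.mul (hf.continuousAt.sub continuousAt_const).norm).add
        (continuousAt_id.dist continuousAt_const)
    exact hcont.eventually_lt_const (by simpa using hε)
  filter_upwards [hsmall] with p hp
  have hsurj := happrox.surjOn_closedBall_of_nonlinearRightInverse g (b := p)
    (ε := 2 * g.nnnorm * ‖f p - f a‖) (by positivity)
    ((closedBall_subset_closedBall' hp.le).trans hεs)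
  obtain ⟨q, hq, hqa⟩ := hsurj (show f a ∈ _ by
    rw [mem_closedBall_iff_norm', NNReal.coe_div, NNReal.coe_inv]
    refine le_of_eq ?_
    simp only [NNReal.coe_ofNat]
    field_simp
    ring)
  exact ⟨q, hqa, mem_closedBall_iff_norm.1 hq⟩

theorem exists_neg_mul_norm_sub_le_of_nonneg_on_fiber (hf : HasStrictFDerivAt f f' a)
    (hf' : f'.range = ⊤) {G : E → ℝ} {L : NNReal} {s : Set E} (hs : s ∈ 𝓝 a)
    (hG : LipschitzOnWith L G s) (hnonneg : ∀ᶠ q in 𝓝 a, f q = f a → 0 ≤ G q) :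
    ∃ K : ℝ, ∀ᶠ p in 𝓝 a, -(K * ‖f p - f a‖) ≤ G p := by
  obtain ⟨K, hnear⟩ := exists_norm_sub_le_mul_of_hasStrictFDerivAt hf hf'
  obtain ⟨δ, hδ, hball⟩ := Metric.mem_nhds_iff.1 (inter_mem hnonneg hs)
  have hsmall : ∀ᶠ p in 𝓝 a, K * ‖f p - f a‖ + ‖p - a‖ < δ := by
    have hcont : ContinuousAt (fun p => K * ‖f p - f a‖ + ‖p - a‖) a :=
      (continuousAt_const.mul (hf.continuousAt.sub continuousAt_const).norm).add
        (continuousAt_id.sub continuousAt_const).norm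
    exact hcont.eventually_lt_const (by simpa using hδ)
  refine ⟨L * K, ?_⟩
  filter_upwards [hnear, hsmall, hs] with p ⟨q, hqa, hqp⟩ hp hps
  have hqball : q ∈ ball a δ := mem_ball_iff_norm.2 <|
    (norm_sub_le_norm_sub_add_norm_sub q p a).trans_lt ((add_le_add_left hqp _).trans_lt hp)
  have hGq : 0 ≤ G q := (hball hqball).1 hqa
  have hLip : G q - G p ≤ L * (K * ‖f p - f a‖) :=
    calc G q - G p ≤ dist (G q) (G p) := le_abs_self _
      _ ≤ L * dist q p := hG.dist_le_mul q (hball hqball).2 p hps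
      _ ≤ L * (K * ‖f p - f a‖) := by rw [dist_eq_norm]; gcongr
  linarith

end LevelSet

section SecondOrder

theorem second_deriv_nonpos_of_isLocalMax {h h' : ℝ → ℝ} {h'' x : ℝ} (hmax : IsLocalMax h x)
    (hd : ∀ᶠ s in 𝓝 x, HasDerivAt h (h' s) s) (hd' : HasDerivAt h' h'' x) : h'' ≤ 0 := by
  by_contra! hpos
  have hderiv : deriv h =ᶠ[𝓝 x] h' := hd.mono fun s hs => hs.deriv
  have hmin : IsLocalMin h x := isLocalMin_of_deriv_deriv_pos
    (by rwa [hderiv.deriv_eq, hd'.deriv]) hmax.deriv_eq_zero hd.self_of_nhds.continuousAt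
  have hconst : h =ᶠ[𝓝 x] fun _ => h x := by
    filter_upwards [hmin, hmax] with s h₁ h₂ using le_antisymm h₂ h₁
  have hzero : h' =ᶠ[𝓝 x] fun _ => 0 := hderiv.symm.trans (by simpa using hconst.deriv)
  exact hpos.ne' (hd'.unique ((hasDerivAt_const x 0).congr_of_eventuallyEq hzero))

theorem deriv_eq_and_second_deriv_le_of_eventuallyLE {f f' g g' : ℝ → ℝ} {f'' g'' x : ℝ}
    (hle : f ≤ᶠ[𝓝 x] g) (heq : f x = g x)
    (hf : ∀ᶠ s in 𝓝 x, HasDerivAt f (f' s) s) (hf' : HasDerivAt f' f'' x)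
    (hg : ∀ᶠ s in 𝓝 x, HasDerivAt g (g' s) s) (hg' : HasDerivAt g' g'' x) :
    f' x = g' x ∧ f'' ≤ g'' := by
  have hmax : IsLocalMax (f - g) x := hle.mono fun s hs => by
    simpa [heq] using hs
  have hd : ∀ᶠ s in 𝓝 x, HasDerivAt (f - g) ((f' - g') s) s := by
    filter_upwards [hf, hg] with s h₁ h₂ using h₁.sub h₂
  exact ⟨sub_eq_zero.1 (hmax.hasDerivAt_eq_zero hd.self_of_nhds),
    sub_nonpos.1 (second_deriv_nonpos_of_isLocalMax hmax hd (hf'.sub hg'))⟩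

variable {E : Type*} [NormedAddCommGroup E] [NormedSpace ℝ E] {r : E → ℝ} {p : E}

theorem eventually_hasDerivAt_comp_line (hr : ContDiffAt ℝ 2 r p) (v : E) :
    ∀ᶠ s in 𝓝 (0 : ℝ), HasDerivAt (fun s : ℝ => r (p + s • v)) (fderiv ℝ r (p + s • v) v) s := by
  have hline : Tendsto (fun s : ℝ => p + s • v) (𝓝 0) (𝓝 p) := by
    simpa using (show Continuous fun s : ℝ => p + s • v by fun_prop).tendsto 0
  filter_upwards [hline.eventually (hr.eventually (by simp))] with s hs
  exact (hs.differentiableAt (by simp)).hasFDerivAt.comp_hasDerivAt s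
    (by simpa using ((hasDerivAt_id s).smul_const v).const_add p)

theorem hasDerivAt_fderiv_comp_line (hr : ContDiffAt ℝ 2 r p) (v : E) :
    HasDerivAt (fun s : ℝ => fderiv ℝ r (p + s • v) v) (fderiv ℝ (fderiv ℝ r) p v v) 0 := by
  have hr' : DifferentiableAt ℝ (fderiv ℝ r) p :=
    (hr.fderiv_right (m := 1) (by norm_num)).differentiableAt (by simp)
  have hline : HasDerivAt (fun s : ℝ => p + s • v) v 0 := by
    simpa using ((hasDerivAt_id (0 : ℝ)).smul_const v).const_add p
  have hcomp : HasDerivAt (fun s : ℝ => fderiv ℝ r (p + s • v)) (fderiv ℝ (fderiv ℝ r) p v) 0 :=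
    hr'.hasFDerivAt.comp_hasDerivAt_of_eq 0 hline (by simp)
  simpa using hcomp.clm_apply (hasDerivAt_const 0 v)

theorem fderiv_eq_and_le_of_isLocalMax_mul_exp (hr : ContDiffAt ℝ 2 r p) {v : E} {x y : ℝ}
    (hmax : IsLocalMax (fun s : ℝ => r (p + s • v) * Real.exp (-(x * s + y * s ^ 2))) 0) :
    fderiv ℝ r p v = r p * x ∧ fderiv ℝ (fderiv ℝ r) p v v ≤ r p * (x ^ 2 + 2 * y) := by
  let g : ℝ → ℝ := fun s => r p * Real.exp (x * s + y * s ^ 2)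
  have hle : (fun s : ℝ => r (p + s • v)) ≤ᶠ[𝓝 0] g := by
    filter_upwards [hmax] with s hs
    rw [Real.exp_neg] at hs
    simpa [g, ← div_eq_mul_inv, div_le_iff₀ (Real.exp_pos _)] using hs
  have hlin : ∀ s, HasDerivAt (fun s : ℝ => x + 2 * y * s) (2 * y) s := fun s => by
    simpa using ((hasDerivAt_id s).const_mul (2 * y)).const_add x
  have hg : ∀ s, HasDerivAt g (g s * (x + 2 * y * s)) s := fun s => by
    have hpoly : HasDerivAt (fun s : ℝ => x * s + y * s ^ 2) (x + 2 * y * s) s :=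
      (((hasDerivAt_id s).const_mul x).add ((hasDerivAt_pow 2 s).const_mul y)).congr_deriv
        (by norm_num; ring)
    exact (hpoly.exp.const_mul (r p)).congr_deriv (by ring)
  have h := deriv_eq_and_second_deriv_le_of_eventuallyLE hle (by simp [g])
    (eventually_hasDerivAt_comp_line hr v) (hasDerivAt_fderiv_comp_line hr v)
    (Eventually.of_forall hg) ((hg 0).mul (hlin 0))
  simpa [g, mul_assoc, ← mul_add, ← sq] using h

end SecondOrder

end GeneralFacts

section MaximumPrinciple

theorem circleAverage_lt_of_continuousOn_of_le {f : ℂ → ℝ} {c : ℂ} {R M : ℝ}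
    (hf : ContinuousOn f (sphere c |R|)) (hle : ∀ ζ ∈ sphere c |R|, f ζ ≤ M)
    (hlt : ∃ ζ ∈ sphere c |R|, f ζ < M) : Real.circleAverage f c R < M := by
  obtain ⟨ζ, hζ, hζM⟩ := hlt
  rw [← image_circleMap_Ioc] at hζ
  obtain ⟨θ, hθ, rfl⟩ := hζ
  have hcont : ContinuousOn (fun θ => f (circleMap c R θ)) (Icc 0 (2 * Real.pi)) :=
    hf.comp (continuous_circleMap c R).continuousOn fun θ _ => circleMap_mem_sphere' c R θ
  have hint : ∫ θ in (0 : ℝ)..2 * Real.pi, f (circleMap c R θ) < ∫ _ in (0 : ℝ)..2 * Real.pi, M :=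
    intervalIntegral.integral_lt_integral_of_continuousOn_of_le_of_exists_lt Real.two_pi_pos hcont
      continuousOn_const (fun θ _ => hle _ (circleMap_mem_sphere' c R θ))
      ⟨θ, Ioc_subset_Icc_self hθ, hζM⟩
  rw [Real.circleAverage_def, smul_eq_mul, inv_mul_lt_iff₀ Real.two_pi_pos]
  simpa using hint

theorem exists_mem_frontier_ge_of_le_circleAverage {u : ℂ → ℝ} {A : Set ℂ} (hA : IsCompact A)
    (hu : ContinuousOn u A)
    (hmean : ∀ c, ∀ δ > 0, closedBall c δ ⊆ A → u c ≤ Real.circleAverage u c δ) {b : ℂ}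
    (hb : b ∈ A) : ∃ q ∈ frontier A, u b ≤ u q := by
  obtain ⟨p, hpA, hp⟩ := hA.exists_isMaxOn ⟨b, hb⟩ hu
  have hS : IsCompact (A ∩ u ⁻¹' {u p}) := hA.of_isClosed_subset
    (hu.preimage_isClosed_of_isClosed hA.isClosed isClosed_singleton) inter_subset_left
  -- Every circle about the rightmost maximum point meets points of smaller value.
  obtain ⟨q, ⟨hqA, hqp⟩, hq⟩ :=
    hS.exists_isMaxOn ⟨p, hpA, rfl⟩ Complex.continuous_re.continuousOn
  rw [mem_preimage, mem_singleton_iff] at hqp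
  refine ⟨q, ⟨subset_closure hqA, fun hint => ?_⟩, hqp ▸ hp hb⟩
  obtain ⟨δ, hδ, hball⟩ := nhds_basis_closedBall.mem_iff.1 (mem_interior_iff_mem_nhds.1 hint)
  have hsphere : sphere q |δ| ⊆ A := by
    rw [abs_of_pos hδ]
    exact sphere_subset_closedBall.trans hball
  have hright : q + δ ∈ sphere q |δ| := by simp
  refine (hmean q δ hδ hball).not_gt (hqp ▸ circleAverage_lt_of_continuousOn_of_le
    (hu.mono hsphere) (fun ζ hζ => hp (hsphere hζ)) ⟨q + δ, hright, ?_⟩)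
  refine lt_of_le_of_ne (hp (hsphere hright)) fun heq => hδ.not_ge ?_
  simpa using hq (show q + δ ∈ A ∩ u ⁻¹' {u p} from ⟨hsphere hright, heq⟩)

theorem IsContinuousPSHOn.exists_mem_frontier_ge {φ : ℂ × ℂ → ℝ} {U : Set (ℂ × ℂ)}
    (hφ : IsContinuousPSHOn φ U) {A : Set ℂ} (hA : IsCompact A) {a : ℂ}
    (hAU : ∀ b ∈ A, (a, b) ∈ U) {b : ℂ} (hb : b ∈ A) :
    ∃ q ∈ frontier A, φ (a, b) ≤ φ (a, q) := by
  refine exists_mem_frontier_ge_of_le_circleAverage hA (u := fun b => φ (a, b))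
    (hφ.1.comp (by fun_prop) hAU) (fun c δ hδ hball => ?_) hb
  have hdisc : ∀ ζ : ℂ, (a, c) + ζ • ((0 : ℂ), (δ : ℂ)) = (a, δ * ζ + c) := fun ζ => by
    simp [mul_comm, add_comm]
  have hmem : ∀ ζ : ℂ, ‖ζ‖ ≤ 1 → δ * ζ + c ∈ A := fun ζ hζ => hball <| by
    simpa [abs_of_pos hδ] using mul_le_of_le_one_right hδ.le hζ
  have hmean := hφ.2 (a, c) (0, δ) fun ζ hζ => hdisc ζ ▸ hAU _ (hmem ζ hζ)
  simpa only [hdisc, ← Real.circleAverage_eq_circleAverage_zero_one (f := fun b => φ (a, b))]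
    using hmean

end MaximumPrinciple

section VerticalHulls

variable {X Y : Type*} [TopologicalSpace X] [TopologicalSpace Y]

/-- The compactness form of the continuity principle for the slices `{a} × A`: those which lie in
`U` and whose relative boundaries `{a} × ∂A` lie in a fixed compact subset of `U` stay in a fixed
compact subset of `U`. -/
def HasVerticalHulls (U : Set (X × Y)) (A : Set Y) : Prop :=
  ∀ K ⊆ U, IsCompact K → ∃ K' ⊆ U, IsCompact K' ∧
    ∀ a, (∀ b ∈ A, (a, b) ∈ U) → (∀ b ∈ frontier A, (a, b) ∈ K) → ∀ b ∈ A, (a, b) ∈ K'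

theorem HasVerticalHulls.forall_mem_of_continuous [T2Space X] [T2Space Y] {T : Type*}
    [TopologicalSpace T] [CompactSpace T] [PreconnectedSpace T] {U : Set (X × Y)} {A : Set Y}
    (h : HasVerticalHulls U A) (hU : IsOpen U) (hA : IsCompact A) {γ : T → X} (hγ : Continuous γ)
    {t₀ : T} (hstart : ∀ b ∈ A, (γ t₀, b) ∈ U) (hfr : ∀ t, ∀ b ∈ frontier A, (γ t, b) ∈ U) (t : T) :
    ∀ b ∈ A, (γ t, b) ∈ U := by
  let F : T × Y → X × Y := Prod.map γ id
  have hF : Continuous F := hγ.prodMap continuous_id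
  have hAfr : IsCompact (frontier A) :=
    hA.of_isClosed_subset isClosed_frontier hA.isClosed.frontier_subset
  obtain ⟨K', hK'U, hK', hull⟩ := h (F '' (univ ×ˢ frontier A))
    (by rintro _ ⟨⟨t, b⟩, ⟨-, hb⟩, rfl⟩; exact hfr t b hb)
    ((isCompact_univ.prod hAfr).image hF)
  have hiff : ∀ t, (∀ b ∈ A, F (t, b) ∈ U) ↔ ∀ b ∈ A, F (t, b) ∈ K' := fun t =>
    ⟨fun ht => hull (γ t) ht fun b hb => ⟨(t, b), ⟨mem_univ t, hb⟩, rfl⟩,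
      fun ht b hb => hK'U (ht b hb)⟩
  have hclopen : IsClopen {t | ∀ b ∈ A, F (t, b) ∈ U} := by
    constructor
    · simp only [hiff, ofPred_forall]
      exact isClosed_biInter fun b _ => hK'.isClosed.preimage <|
        show Continuous fun t => F (t, b) from hF.comp (.prodMk_left b)
    · rw [isOpen_iff_mem_nhds]
      exact fun t ht => hA.eventually_forall_of_forall_eventually fun b hb =>
        (hU.preimage hF).mem_nhds (ht b hb)
  exact eq_univ_iff_forall.1 (hclopen.eq_univ ⟨t₀, hstart⟩) t

theorem hasVerticalHulls_setOf_neg {g : X × Y → ℝ} (hg : Continuous g)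
    (hcomp : IsCompact (closure {z | g z < 0}))
    (hmax : ∀ᶠ z in 𝓝ˢ (frontier {z | g z < 0}),
      g z < 0 → ¬ IsLocalMax (fun b => g (z.1, b)) z.2) {A : Set Y} (hA : IsCompact A) :
    HasVerticalHulls {z | g z < 0} A := by
  obtain ⟨N, hNo, hfrN, hN⟩ := eventually_nhdsSet_iff_exists.1 hmax
  intro K hKU hK
  let S : Set (X × Y) := K ∪ closure {z | g z < 0} \ N
  have hSneg : ∀ z ∈ S, g z < 0 := by
    rintro z (hz | ⟨hz, hzN⟩)
    · exact hKU hz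
    · exact show z ∈ {z | g z < 0} from
        interior_subset (not_not.1 fun hint => hzN (hfrN ⟨hz, hint⟩))
  obtain ⟨m, hm, hSm⟩ : ∃ m < 0, ∀ z ∈ S, g z ≤ m := by
    rcases S.eq_empty_or_nonempty with hS | hS
    · exact ⟨-1, by simp, by simp [hS]⟩
    · obtain ⟨z, hz, hzmax⟩ := (hK.union (hcomp.diff hNo)).exists_isMaxOn hS hg.continuousOn
      exact ⟨g z, hSneg z hz, hzmax⟩
  have hsub : {z | g z ≤ m} ⊆ {z | g z < 0} := fun z hz => lt_of_le_of_lt hz hm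
  refine ⟨_, hsub, hcomp.of_isClosed_subset (isClosed_le hg continuous_const)
    (hsub.trans subset_closure), fun a hAU hfrK b hb => ?_⟩
  obtain ⟨p, hpA, hp⟩ := hA.exists_isMaxOn ⟨b, hb⟩
    (hg.comp (continuous_const.prodMk continuous_id)).continuousOn
  refine (show g (a, b) ≤ g (a, p) from hp hb).trans (hSm _ ?_)
  by_cases hint : p ∈ interior A
  · exact .inr ⟨subset_closure (hAU p hpA), fun hpN =>
      hN _ hpN (hAU p hpA) (hp.isLocalMax (mem_interior_iff_mem_nhds.1 hint))⟩
  · exact .inl (hfrK p ⟨subset_closure hpA, hint⟩)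

theorem IsPseudoconvex.hasVerticalHulls {U : Set (ℂ × ℂ)} (hU : IsPseudoconvex U) {A : Set ℂ}
    (hA : IsCompact A) : HasVerticalHulls U A := by
  obtain ⟨-, φ, hφ, hexhaustion⟩ := hU
  intro K hKU hK
  obtain ⟨c, hc⟩ := hK.bddAbove_image (hφ.1.mono hKU)
  refine ⟨_, fun z hz => hz.1, hexhaustion c, fun a hAU hfrK b hb => ⟨hAU b hb, ?_⟩⟩
  obtain ⟨q, hq, hbq⟩ := hφ.exists_mem_frontier_ge hA hAU hb
  exact hbq.trans (hc ⟨_, hfrK q hq, rfl⟩)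

end VerticalHulls

section LeviForm

/-- The `(1, 0)`-form `2∂r(p)`, encoded as the complex linear functional with real part `dr(p)`. -/
noncomputable def twoDel (r : ℂ × ℂ → ℝ) (p : ℂ × ℂ) : (ℂ × ℂ) →L[ℂ] ℂ :=
  StrongDual.extendRCLike (fderiv ℝ r p)

variable {r : ℂ × ℂ → ℝ} {p : ℂ × ℂ}

theorem twoDel_apply (r : ℂ × ℂ → ℝ) (p w : ℂ × ℂ) :
    twoDel r p w = fderiv ℝ r p w - Complex.I * fderiv ℝ r p (Complex.I • w) :=
  rfl

theorem isComplexTangent_iff_twoDel_eq_zero {w : ℂ × ℂ} :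
    IsComplexTangent r p w ↔ twoDel r p w = 0 := by
  simp [IsComplexTangent, twoDel_apply, Complex.ext_iff]

theorem twoDel_eq_zero_iff : twoDel r p = 0 ↔ fderiv ℝ r p = 0 :=
  (StrongDual.extendRCLikeₗ (𝕜 := ℂ) (F := ℂ × ℂ)).map_eq_zero_iff (x := fderiv ℝ r p)

theorem contDiffAt_twoDel_apply {n : ℕ∞ω} (hr : ContDiffAt ℝ (n + 1) r p) (w : ℂ × ℂ) :
    ContDiffAt ℝ n (fun q => twoDel r q w) p := by
  have h : ∀ v, ContDiffAt ℝ n (fun q => (fderiv ℝ r q v : ℂ)) p := fun v =>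
    Complex.ofRealCLM.contDiff.contDiffAt.comp p
      ((hr.fderiv_right le_rfl).clm_apply contDiffAt_const)
  exact (h w).sub (contDiffAt_const.mul (h (Complex.I • w)))

theorem contDiffAt_leviForm_apply {n : ℕ∞ω} (hr : ContDiffAt ℝ (n + 2) r p) {w : ℂ × ℂ → ℂ × ℂ}
    (hw : ContDiffAt ℝ n w p) : ContDiffAt ℝ n (fun q => leviForm r q (w q)) p := by
  have hr' : ContDiffAt ℝ n (fderiv ℝ (fderiv ℝ r)) p :=
    (hr.fderiv_right (m := n + 1) (by rw [add_assoc, one_add_one_eq_two])).fderiv_right le_rfl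
  have hIw : ContDiffAt ℝ n (fun q => Complex.I • w q) p :=
    (contDiff_const_smul Complex.I).contDiffAt.comp p hw
  exact (((hr'.clm_apply hw).clm_apply hw).add
    ((hr'.clm_apply hIw).clm_apply hIw)).div_const 4

theorem abs_leviForm_sub_leviForm_le (v w : ℂ × ℂ) :
    |leviForm r p v - leviForm r p w| ≤
      ‖fderiv ℝ (fderiv ℝ r) p‖ * (‖v - w‖ * (‖v‖ + ‖w‖)) / 2 := by
  have h₁ := norm_apply_self_sub_apply_self_le (fderiv ℝ (fderiv ℝ r) p) v w
  have h₂ := norm_apply_self_sub_apply_self_le (fderiv ℝ (fderiv ℝ r) p)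
    (Complex.I • v) (Complex.I • w)
  rw [← smul_sub, norm_smul, norm_smul, norm_smul, Complex.norm_I, one_mul, one_mul, one_mul] at h₂
  rw [Real.norm_eq_abs, abs_le] at h₁ h₂
  rw [leviForm, leviForm, abs_le]
  constructor <;> linarith

theorem exists_eventually_leviForm_ge_of_twoDel_ne_zero (hr : ContDiffAt ℝ 3 r p)
    (hlevi : ∀ᶠ q in 𝓝 p, r q = r p → ∀ w, IsComplexTangent r q w → 0 ≤ leviForm r q w)
    {v : ℂ × ℂ} (hv : twoDel r p v ≠ 0) (e : ℂ × ℂ) :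
    ∃ K : ℝ, ∀ᶠ q in 𝓝 p,
      -(K * ‖r q - r p‖) ≤ leviForm r q (e - (twoDel r q e / twoDel r q v) • v) := by
  have hdel : ∀ w, ContDiffAt ℝ 1 (fun q => twoDel r q w) p :=
    contDiffAt_twoDel_apply (hr.of_le (by norm_num))
  have hproj : ContDiffAt ℝ 1 (fun q => e - (twoDel r q e / twoDel r q v) • v) p := by
    have hdiv : ContDiffAt ℝ 1 (fun q => twoDel r q e / twoDel r q v) p := by
      simp only [div_eq_mul_inv]
      exact (hdel e).mul ((hdel v).inv hv)
    exact contDiffAt_const.sub (hdiv.smul contDiffAt_const)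
  obtain ⟨L, s, hs, hL⟩ :=
    (contDiffAt_leviForm_apply (hr.of_le (by norm_num)) hproj).exists_lipschitzOnWith
  have hd : fderiv ℝ r p ≠ 0 := fun h => hv (by rw [twoDel_eq_zero_iff.2 h]; rfl)
  refine exists_neg_mul_norm_sub_le_of_nonneg_on_fiber (hr.hasStrictFDerivAt (by norm_num))
    (LinearMap.range_eq_top.2 <| LinearMap.surjective fun h => hd ?_) hs hL ?_
  · exact ContinuousLinearMap.coe_inj.1 h
  · filter_upwards [hlevi, (hdel v).continuousAt.eventually_ne hv] with q hq hqv hqp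
    exact hq hqp _ (isComplexTangent_iff_twoDel_eq_zero.2 (by simp [hqv]))

theorem exists_eventually_leviForm_ge (hr : ContDiffAt ℝ 3 r p) (hd : fderiv ℝ r p ≠ 0)
    (hlevi : ∀ᶠ q in 𝓝 p, r q = r p → ∀ w, IsComplexTangent r q w → 0 ≤ leviForm r q w)
    (e : ℂ × ℂ) :
    ∃ K : ℝ, ∀ᶠ q in 𝓝 p, -(K * (|r q - r p| + ‖twoDel r q e‖)) ≤ leviForm r q e := by
  obtain ⟨v, hv⟩ := DFunLike.exists_ne (mt twoDel_eq_zero_iff.1 hd)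
  obtain ⟨K, hK⟩ := exists_eventually_leviForm_ge_of_twoDel_ne_zero hr hlevi hv e
  have hdel : ∀ w, ContinuousAt (fun q => twoDel r q w) p := fun w =>
    (contDiffAt_twoDel_apply (n := 2) (hr.of_le (by norm_num)) w).continuousAt
  let c : ℂ × ℂ → ℂ := fun q => twoDel r q e / twoDel r q v
  let B : ℂ × ℂ → ℝ := fun q =>
    ‖fderiv ℝ (fderiv ℝ r) q‖ * (‖v‖ / ‖twoDel r q v‖ * (‖e‖ + ‖e - c q • v‖)) / 2
  have hB : ContinuousAt B p := by
    have hr' : ContinuousAt (fderiv ℝ (fderiv ℝ r)) p :=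
      ((hr.fderiv_right (m := 2) (by norm_num)).fderiv_right (m := 1) (by norm_num)).continuousAt
    have hcoef : ContinuousAt (fun q => ‖v‖ / ‖twoDel r q v‖) p :=
      continuousAt_const.div₀ (hdel v).norm (norm_ne_zero_iff.2 hv)
    have hproj : ContinuousAt (fun q => ‖e‖ + ‖e - c q • v‖) p :=
      continuousAt_const.add
        (continuousAt_const.sub (((hdel e).div₀ (hdel v) hv).smul continuousAt_const)).norm
    have hnorm : ContinuousAt (fun q => ‖fderiv ℝ (fderiv ℝ r) q‖) p :=
      hr'.norm (E := ℂ × ℂ →L[ℝ] ℂ × ℂ →L[ℝ] ℝ)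
    exact (hnorm.mul (hcoef.mul hproj)).div_const 2
  refine ⟨max K (B p + 1), ?_⟩
  filter_upwards [hK, hB.eventually_le_const (lt_add_one (B p))] with q hKq hBq
  have hdiff : |leviForm r q e - leviForm r q (e - c q • v)| ≤ B q * ‖twoDel r q e‖ :=
    (abs_leviForm_sub_leviForm_le _ _).trans_eq (by
      rw [sub_sub_cancel, norm_smul, norm_div]
      ring)
  have hKmax : K * |r q - r p| ≤ max K (B p + 1) * |r q - r p| := by
    gcongr
    exact le_max_left _ _
  have hBmax : B q * ‖twoDel r q e‖ ≤ max K (B p + 1) * ‖twoDel r q e‖ := by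
    gcongr
    exact hBq.trans (le_max_right _ _)
  rw [Real.norm_eq_abs] at hKq
  linarith [neg_le_of_abs_le hdiff]

theorem exists_eventually_nhdsSet_leviForm_ge (hr : ContDiff ℝ 3 r)
    (hb : Bornology.IsBounded {p | r p < 0}) (hd : ∀ p, r p = 0 → fderiv ℝ r p ≠ 0)
    (hlevi : ∀ p, r p = 0 → ∀ w, IsComplexTangent r p w → 0 ≤ leviForm r p w) (e : ℂ × ℂ) :
    ∃ K : ℝ, ∀ᶠ p in 𝓝ˢ (frontier {p | r p < 0}),
      -(K * (|r p| + ‖twoDel r p e‖)) ≤ leviForm r p e := by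
  have hcomp : IsCompact (frontier {p | r p < 0}) :=
    hb.isCompact_closure.of_isClosed_subset isClosed_frontier frontier_subset_closure
  refine exists_eventually_nhdsSet_of_forall_exists_eventually hcomp
    (fun p K L hKL h => (neg_le_neg (by gcongr)).trans h) fun p hp => ?_
  rw [frontier_setOf_neg_eq hr.continuous hd] at hp
  have hp0 : r p = 0 := hp
  simpa only [hp0, sub_zero] using exists_eventually_leviForm_ge hr.contDiffAt (hd p hp0)
    (Eventually.of_forall fun q hq => hlevi q (hq.trans hp0)) e

theorem fderiv_prod_eq_and_le_of_isLocalMax_mul_exp {E F : Type*} [NormedAddCommGroup E]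
    [NormedSpace ℝ E] [NormedAddCommGroup F] [InnerProductSpace ℝ F] {r : E × F → ℝ} {a : E} {b : F}
    (hr : ContDiffAt ℝ 2 r (a, b)) {C : ℝ}
    (hmax : IsLocalMax (fun b => r (a, b) * Real.exp (-(C * ‖b‖ ^ 2))) b) (c : F) :
    fderiv ℝ r (a, b) (0, c) = r (a, b) * (2 * C * inner ℝ b c) ∧
      fderiv ℝ (fderiv ℝ r) (a, b) (0, c) (0, c) ≤
        r (a, b) * ((2 * C * inner ℝ b c) ^ 2 + 2 * (C * ‖c‖ ^ 2)) := by
  refine fderiv_eq_and_le_of_isLocalMax_mul_exp hr ?_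
  have hline : Tendsto (fun s : ℝ => b + s • c) (𝓝 0) (𝓝 b) := by
    simpa using (show Continuous fun s : ℝ => b + s • c by fun_prop).tendsto 0
  filter_upwards [hline.eventually hmax] with s hs
  have hexp : Real.exp (-(C * ‖b + s • c‖ ^ 2)) = Real.exp (-(C * ‖b‖ ^ 2)) *
      Real.exp (-(2 * C * inner ℝ b c * s + C * ‖c‖ ^ 2 * s ^ 2)) := by
    rw [norm_add_sq_real, inner_smul_right, norm_smul, mul_pow, Real.norm_eq_abs, sq_abs,
      ← Real.exp_add]
    ring_nf
  rw [hexp, mul_left_comm, mul_comm (r (a, b))] at hs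
  simpa using le_of_mul_le_mul_left hs (Real.exp_pos _)

theorem norm_twoDel_eq_and_leviForm_le_of_isLocalMax_mul_exp {C : ℝ} {a b : ℂ}
    (hr : ContDiffAt ℝ 2 r (a, b))
    (hmax : IsLocalMax (fun b => r (a, b) * Real.exp (-(C * ‖b‖ ^ 2))) b) :
    ‖twoDel r (a, b) (0, 1)‖ = |r (a, b)| * (2 * |C| * ‖b‖) ∧
      leviForm r (a, b) (0, 1) ≤ r (a, b) * (C + C ^ 2 * ‖b‖ ^ 2) := by
  obtain ⟨h₁, h₁'⟩ := fderiv_prod_eq_and_le_of_isLocalMax_mul_exp hr hmax 1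
  obtain ⟨hI, hI'⟩ := fderiv_prod_eq_and_le_of_isLocalMax_mul_exp hr hmax Complex.I
  have hre : inner ℝ b 1 = b.re := by simp [Complex.inner]
  have him : inner ℝ b Complex.I = b.im := by simp [Complex.inner]
  rw [hre] at h₁ h₁'
  rw [him] at hI hI'
  rw [norm_one] at h₁'
  rw [Complex.norm_I] at hI'
  have hsmul : Complex.I • ((0 : ℂ), (1 : ℂ)) = (0, Complex.I) := by simp
  constructor
  · have hdel : twoDel r (a, b) (0, 1) = (r (a, b) : ℂ) * (2 * C * starRingEnd ℂ b) := by
      rw [twoDel_apply, hsmul, h₁, hI]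
      apply Complex.ext <;> simp
    simp [hdel]
  · have hsq : ‖b‖ ^ 2 = b.re ^ 2 + b.im ^ 2 := by
      rw [Complex.sq_norm, Complex.normSq_apply, sq, sq]
    rw [leviForm, hsmul, hsq]
    linarith

theorem not_isLocalMax_mul_exp_of_leviForm_ge {K C : ℝ} {a b : ℂ} (hC : 0 < C) (hKC : K + K ^ 2 < C)
    (hr : ContDiffAt ℝ 2 r (a, b)) (hneg : r (a, b) < 0)
    (hK : -(K * (|r (a, b)| + ‖twoDel r (a, b) (0, 1)‖)) ≤ leviForm r (a, b) (0, 1)) :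
    ¬ IsLocalMax (fun b => r (a, b) * Real.exp (-(C * ‖b‖ ^ 2))) b := by
  intro hmax
  obtain ⟨hdel, hlevi⟩ := norm_twoDel_eq_and_leviForm_le_of_isLocalMax_mul_exp hr hmax
  rw [hdel, abs_of_neg hneg, abs_of_pos hC] at hK
  have hpos : 0 < C + C ^ 2 * ‖b‖ ^ 2 - K * (1 + 2 * C * ‖b‖) :=
    calc 0 < (C * ‖b‖ - K) ^ 2 + (C - (K + K ^ 2)) :=
          add_pos_of_nonneg_of_pos (sq_nonneg _) (sub_pos.2 hKC)
      _ = _ := by ring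
  linarith [mul_neg_of_neg_of_pos hneg hpos]

theorem hasVerticalHulls_of_leviForm_nonneg (hr : ContDiff ℝ 3 r)
    (hb : Bornology.IsBounded {p | r p < 0}) (hd : ∀ p, r p = 0 → fderiv ℝ r p ≠ 0)
    (hlevi : ∀ p, r p = 0 → ∀ w, IsComplexTangent r p w → 0 ≤ leviForm r p w) {A : Set ℂ}
    (hA : IsCompact A) : HasVerticalHulls {p | r p < 0} A := by
  obtain ⟨K, hK⟩ := exists_eventually_nhdsSet_leviForm_ge hr hb hd hlevi (0, 1)
  let C := K + K ^ 2 + 1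
  have hC : 0 < C := by nlinarith [sq_nonneg (K + 1)]
  let g : ℂ × ℂ → ℝ := fun z => r z * Real.exp (-(C * ‖z.2‖ ^ 2))
  have hg : Continuous g := by
    have := hr.continuous
    fun_prop
  have hneg : {z | g z < 0} = {z | r z < 0} := by
    ext z
    simp [g, mul_neg_iff, Real.exp_pos, (Real.exp_pos _).not_gt]
  rw [← hneg]
  refine hasVerticalHulls_setOf_neg hg (hneg ▸ hb.isCompact_closure) ?_ hA
  rw [hneg]
  filter_upwards [hK] with z hz hgz
  exact not_isLocalMax_mul_exp_of_leviForm_ge hC (lt_add_one _)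
    (hr.contDiffAt.of_le (by norm_num)) (hneg.subset hgz) hz

theorem IsSmoothlyBoundedPseudoconvexDomain.isOpen {U : Set (ℂ × ℂ)}
    (hU : IsSmoothlyBoundedPseudoconvexDomain U) : IsOpen U := by
  obtain ⟨-, -, r, hr, -⟩ := hU
  exact hr.eq_neg ▸ isOpen_lt hr.smooth.continuous continuous_const

theorem IsSmoothlyBoundedPseudoconvexDomain.hasVerticalHulls {U : Set (ℂ × ℂ)}
    (hU : IsSmoothlyBoundedPseudoconvexDomain U) {A : Set ℂ} (hA : IsCompact A) :
    HasVerticalHulls U A := by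
  obtain ⟨-, hb, r, ⟨hr, rfl, hd⟩, hlevi⟩ := hU
  rw [frontier_setOf_neg_eq hr.continuous hd] at hlevi
  exact hasVerticalHulls_of_leviForm_nonneg (contDiff_infty.1 hr 3) hb hd hlevi hA

end LeviForm

section Worm

/-- The closed annulus `|log |w|²| ≤ τ`. -/
def logAnnulus (τ : ℝ) : Set ℂ :=
  {w | w ≠ 0 ∧ |wormAngle w| ≤ τ}

theorem continuousAt_wormAngle {w : ℂ} (hw : w ≠ 0) : ContinuousAt wormAngle w :=
  ContinuousAt.log (by fun_prop) (by simpa using hw)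

theorem logAnnulus_eq_preimage_Icc (τ : ℝ) :
    logAnnulus τ = (fun w => ‖w‖ ^ 2) ⁻¹' Icc (Real.exp (-τ)) (Real.exp τ) := by
  ext w
  rcases eq_or_ne w 0 with rfl | hw
  · simp [logAnnulus, Real.exp_pos]
  · have hpos : 0 < ‖w‖ ^ 2 := by positivity
    rw [logAnnulus, mem_ofPred_eq, mem_preimage, mem_Icc, and_iff_right hw, wormAngle, abs_le,
      Real.le_log_iff_exp_le hpos, Real.log_le_iff_le_exp hpos]

theorem isCompact_logAnnulus (τ : ℝ) : IsCompact (logAnnulus τ) := by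
  rw [logAnnulus_eq_preimage_Icc]
  refine isCompact_of_isClosed_isBounded (isClosed_Icc.preimage (by fun_prop)) ?_
  exact isBounded_iff_forall_norm_le.2 ⟨√(Real.exp τ), fun w hw => Real.le_sqrt_of_sq_le hw.2⟩

theorem abs_wormAngle_eq_of_mem_frontier {τ : ℝ} {w : ℂ} (hw : w ∈ frontier (logAnnulus τ)) :
    |wormAngle w| = τ := by
  obtain ⟨hw0, hwτ⟩ := (isCompact_logAnnulus τ).isClosed.frontier_subset hw
  refine hwτ.eq_of_not_lt fun hlt => hw.2 (mem_interior_iff_mem_nhds.2 ?_)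
  filter_upwards [(continuousAt_wormAngle hw0).abs.eventually_lt_const hlt,
    isOpen_ne.mem_nhds hw0] with v hv hv0 using ⟨hv0, hv.le⟩

variable {η : ℝ → ℝ} {τ : ℝ}

theorem mem_closure_wormDomain {z : ℂ × ℂ} (hz : z.2 ≠ 0) (hη : η (wormAngle z.2) = 0)
    (hdist : ‖z.1 - Complex.exp (Complex.I * (wormAngle z.2 : ℂ))‖ ≤ 1) :
    z ∈ closure (wormDomain η) := by
  have hmaps : MapsTo (fun a : ℂ => (a, z.2))
      (ball (Complex.exp (Complex.I * (wormAngle z.2 : ℂ))) 1) (wormDomain η) := fun a ha =>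
    ⟨hz, by simpa [hη, dist_eq_norm] using ha⟩
  have hball : z.1 ∈ closure (ball (Complex.exp (Complex.I * (wormAngle z.2 : ℂ))) 1) := by
    rwa [closure_ball _ one_ne_zero, mem_closedBall_iff_norm]
  exact hmaps.closure (by fun_prop) hball

theorem filledHartogsFigure_subset_of_hasVerticalHulls (hη : ∀ x ∈ Icc (-τ) τ, η x = 0)
    {U : Set (ℂ × ℂ)} (hU : IsOpen U) (hull : HasVerticalHulls U (logAnnulus τ))
    (hWU : closure (wormDomain η) ⊆ U) : filledHartogsFigure τ ⊆ U := by
  rintro ⟨a, b⟩ ⟨hb, hbτ, hplus, hminus⟩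
  have hmem : ∀ a, ∀ w ∈ logAnnulus τ,
      ‖a - Complex.exp (Complex.I * (wormAngle w : ℂ))‖ ≤ 1 → (a, w) ∈ U := fun a w hw hdist =>
    hWU (mem_closure_wormDomain hw.1 (hη _ (abs_le.1 hw.2)) hdist)
  have hslices := hull.forall_mem_of_continuous hU (isCompact_logAnnulus τ)
    (γ := fun t : unitInterval => (t : ℝ) • a) (by fun_prop) (t₀ := 0) ?_ ?_ 1 b ⟨hb, hbτ⟩
  · simpa using hslices
  · intro w hw
    exact hmem _ w hw (by simp [Complex.norm_exp_I_mul_ofReal])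
  · intro t w hw
    refine hmem _ w ((isCompact_logAnnulus τ).isClosed.frontier_subset hw) ?_
    have hnorm := Complex.norm_exp_I_mul_ofReal (wormAngle w)
    refine (norm_smul_sub_le_norm (hnorm ▸ ?_) t.2).trans_eq hnorm
    rcases eq_or_eq_neg_of_abs_eq (abs_wormAngle_eq_of_mem_frontier hw) with h | h
    · simpa [h] using hplus
    · simpa [h] using hminus

theorem filledHartogsFigure_subset_of_pseudoconvex (hη : ∀ x ∈ Icc (-τ) τ, η x = 0)
    {U : Set (ℂ × ℂ)} (hU : IsPseudoconvex U ∨ IsSmoothlyBoundedPseudoconvexDomain U)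
    (hWU : closure (wormDomain η) ⊆ U) : filledHartogsFigure τ ⊆ U := by
  rcases hU with hU | hU
  · exact filledHartogsFigure_subset_of_hasVerticalHulls hη hU.1
      (hU.hasVerticalHulls (isCompact_logAnnulus τ)) hWU
  · exact filledHartogsFigure_subset_of_hasVerticalHulls hη hU.isOpen
      (hU.hasVerticalHulls (isCompact_logAnnulus τ)) hWU

theorem wormAngle_one : wormAngle 1 = 0 := by
  simp [wormAngle]

theorem two_cos_mem_filledHartogsFigure (hτ : 0 ≤ τ) :
    (((2 * Real.cos τ : ℝ) : ℂ), (1 : ℂ)) ∈ filledHartogsFigure τ := by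
  have hcos : ((2 * Real.cos τ : ℝ) : ℂ) =
      Complex.exp (Complex.I * τ) + Complex.exp (-(Complex.I * τ)) := by
    rw [Complex.ofReal_mul, Complex.ofReal_cos, Complex.ofReal_ofNat, Complex.two_cos, neg_mul,
      mul_comm]
  have hnorm := Complex.norm_exp_I_mul_ofReal (-τ)
  rw [Complex.ofReal_neg, mul_neg] at hnorm
  refine ⟨one_ne_zero, by rwa [wormAngle_one, abs_zero], ?_, ?_⟩
  · simp only [hcos, add_sub_cancel_left, hnorm, le_refl]
  · simp only [hcos, add_sub_cancel_right, Complex.norm_exp_I_mul_ofReal, le_refl]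

theorem norm_sub_one_le_one_of_mem_closure_wormDomain (hη : ∀ᶠ x in 𝓝 0, 0 ≤ η x) {a : ℂ}
    (ha : (a, 1) ∈ closure (wormDomain η)) : ‖a - 1‖ ≤ 1 := by
  have hangle : ContinuousAt (fun z : ℂ × ℂ => wormAngle z.2) (a, 1) :=
    ContinuousAt.comp' (continuousAt_wormAngle one_ne_zero) continuousAt_snd
  have hdist : ContinuousAt (fun z : ℂ × ℂ =>
      ‖z.1 - Complex.exp (Complex.I * (wormAngle z.2 : ℂ))‖ ^ 2) (a, 1) :=
    ((continuousAt_fst.sub (continuousAt_const.mul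
      (Complex.continuous_ofReal.continuousAt.comp' hangle)).cexp).norm).pow 2
  have hnonneg : ∀ᶠ z : ℂ × ℂ in 𝓝 (a, 1), 0 ≤ η (wormAngle z.2) :=
    hangle.eventually (by simpa only [wormAngle_one] using hη)
  have hle := le_of_tendsto_of_frequently hdist <|
    ((mem_closure_iff_frequently.1 ha).and_eventually hnonneg).mono fun z hz =>
      hz.1.2.le.trans (sub_le_self 1 hz.2)
  simpa [wormAngle_one] using hle

theorem two_cos_notMem_closure_wormDomain (hη : ∀ᶠ x in 𝓝 0, 0 ≤ η x) (hτ : Real.cos τ < 0) :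
    (((2 * Real.cos τ : ℝ) : ℂ), (1 : ℂ)) ∉ closure (wormDomain η) := fun hmem => by
  have h := (Complex.abs_re_le_norm _).trans (norm_sub_one_le_one_of_mem_closure_wormDomain hη hmem)
  rw [Complex.sub_re, Complex.ofReal_re, Complex.one_re, abs_le] at h
  linarith

end Worm

theorem hasNontrivialNebenhulle_of_notMem_closure {Ω : Set (ℂ × ℂ)} {p : ℂ × ℂ} (hp : p ∉ closure Ω)
    (hmem : ∀ U, IsSmoothlyBoundedPseudoconvexDomain U → closure Ω ⊆ U → p ∈ U) :
    HasNontrivialNebenhulle Ω := by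
  rintro ⟨W, hW, -, hΩW, hinter⟩
  exact hp (hinter ▸ mem_iInter.2 fun j => hmem (W j) (hW j) (hΩW j))

theorem mainTheorem9_general {μ : ℝ} (hμ : Real.pi / 2 < μ) {η : ℝ → ℝ}
    (hη : ∀ x ∈ Icc (-μ) μ, η x = 0) :
    HasNontrivialNebenhulle (wormDomain η) ∧
    (∃ V : Set (ℂ × ℂ), IsOpen V ∧ closure (wormDomain η) ⊆ V ∧
      ¬ ∃ U : Set (ℂ × ℂ), (IsPseudoconvex U ∨ IsSmoothlyBoundedPseudoconvexDomain U) ∧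
        closure (wormDomain η) ⊆ U ∧ U ⊆ V) ∧
    (∀ τ : ℝ, Real.pi / 2 < τ → τ ≤ μ → τ ≤ Real.pi →
      ¬ filledHartogsFigure τ ⊆ closure (wormDomain η) ∧
      ∀ U : Set (ℂ × ℂ), IsPseudoconvex U ∨ IsSmoothlyBoundedPseudoconvexDomain U →
        closure (wormDomain η) ⊆ U → filledHartogsFigure τ ⊆ U) := by
  have hμ₀ : 0 < μ := Real.pi_div_two_pos.trans hμ
  have hη₀ : ∀ᶠ x in 𝓝 0, 0 ≤ η x := by
    filter_upwards [Icc_mem_nhds (neg_neg_of_pos hμ₀) hμ₀] with x hx using (hη x hx).ge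
  have hnot : ∀ τ, Real.pi / 2 < τ → τ ≤ Real.pi →
      ¬ filledHartogsFigure τ ⊆ closure (wormDomain η) := fun τ hτ hτπ hsub =>
    two_cos_notMem_closure_wormDomain hη₀
      (Real.cos_neg_of_pi_div_two_lt_of_lt hτ (by linarith [Real.pi_pos]))
      (hsub (two_cos_mem_filledHartogsFigure (Real.pi_div_two_pos.trans hτ).le))
  have hsub : ∀ τ ≤ μ, ∀ U, IsPseudoconvex U ∨ IsSmoothlyBoundedPseudoconvexDomain U →
      closure (wormDomain η) ⊆ U → filledHartogsFigure τ ⊆ U := fun τ hτ U =>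
    filledHartogsFigure_subset_of_pseudoconvex fun x hx => hη x (Icc_subset_Icc (by simpa) hτ hx)
  obtain ⟨p, hpin, hpout⟩ := not_subset.1 <|
    hnot (min μ Real.pi) (lt_min hμ (half_lt_self Real.pi_pos)) (min_le_right _ _)
  have hmem : ∀ U, IsPseudoconvex U ∨ IsSmoothlyBoundedPseudoconvexDomain U →
      closure (wormDomain η) ⊆ U → p ∈ U := fun U hU hΩU =>
    hsub _ (min_le_left _ _) U hU hΩU hpin
  exact ⟨hasNontrivialNebenhulle_of_notMem_closure hpout fun U hU => hmem U (.inr hU),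
    ⟨{p}ᶜ, isOpen_compl_singleton, subset_compl_singleton_iff.2 hpout,
      fun ⟨U, hU, hΩU, hUp⟩ => hUp (hmem U hU hΩU) rfl⟩,
    fun τ hτ hτμ hτπ => ⟨hnot τ hτ hτπ, hsub τ hτμ⟩⟩

theorem mainTheorem9 (μ : ℝ) (hμ : Real.pi / 2 < μ) (η : ℝ → ℝ) (hη : IsWormProfile μ η) :
    HasNontrivialNebenhulle (wormDomain η) ∧
    (∃ V : Set (ℂ × ℂ), IsOpen V ∧ closure (wormDomain η) ⊆ V ∧
      ¬ ∃ U : Set (ℂ × ℂ), (IsPseudoconvex U ∨ IsSmoothlyBoundedPseudoconvexDomain U) ∧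
        closure (wormDomain η) ⊆ U ∧ U ⊆ V) ∧
    (∀ τ : ℝ, Real.pi / 2 < τ → τ ≤ μ → τ ≤ Real.pi →
      ¬ filledHartogsFigure τ ⊆ closure (wormDomain η) ∧
      ∀ U : Set (ℂ × ℂ), IsPseudoconvex U ∨ IsSmoothlyBoundedPseudoconvexDomain U →
        closure (wormDomain η) ⊆ U → filledHartogsFigure τ ⊆ U) :=
  mainTheorem9_general hμ hη.zero_set.superset
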